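/- **Theorem.** Let $\mathcal V$ be a variety of Heyting algebras, that is, the class of all Heyting algebras satisfying some fixed set of equations $p\approx q$ between terms in the language $(\wedge,\vee,\to,0,1)$. If $\mathcal V$ is closed under MacNeille completions, then $\mathcal V$ is closed under hyper-MacNeille completions; and if $\mathcal V$ is closed under hyper-MacNeille completions, then $\mathcal V$ is closed under canonical completions. Here, for a Heyting algebra $A$: * the *MacNeille completion* $\overline A$ is the complete lattice of all subsets $X\subseteq A$ that coincide with the set of lower bounds of the set of upper bounds of $X$, ordered by inclusion; * the *hyper-MacNeille completion* $A^+$ is the complete lattice, ordered by inclusion, of the Galois closed subsets $X=LU(X)$ of $W=A\times A$, where $U(X)=\{u\in W : w\,N\,u \text{ for all } w\in X\}$, $L(Y)=\{w\in W : w\,N\,u\text{ for all }u\in Y\}$ and $$(s,a)\,N\,(t,b)\iff s\vee t\vee(a\to b)=1;$$ * the *canonical completion* $A^\sigma$ is the complete lattice, ordered by inclusion, of all upsets of the set of prime filters of $A$, where the prime filters are themselves ordered by inclusion. Each of these complete lattices is a Heyting algebra, with the implication determined by its order, and $\mathcal V$ is closed under the respective kind of completion if for every $A\in\mathcal V$ the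 corresponding completion of $A$ belongs to $\mathcal V$. -/

import Mathlib

/-! ### Varieties of Heyting algebras -/

/-- Terms in the language `(∧, ∨, →, 0, 1)` of Heyting algebras, over countably many variables. -/
inductive HeytingTerm : Type
  | var (n : ℕ) : HeytingTerm
  | bot : HeytingTerm
  | top : HeytingTerm
  | inf (p q : HeytingTerm) : HeytingTerm
  | sup (p q : HeytingTerm) : HeytingTerm
  | imp (p q : HeytingTerm) : HeytingTerm

/-- The value of a term in a Heyting algebra under an assignment of the variables. -/
def HeytingTerm.eval {A : Type*} [HeytingAlgebra A] (v : ℕ → A) : HeytingTerm → A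
  | .var n => v n
  | .bot => ⊥
  | .top => ⊤
  | .inf p q => p.eval v ⊓ q.eval v
  | .sup p q => p.eval v ⊔ q.eval v
  | .imp p q => p.eval v ⇨ q.eval v

/-- A variety of Heyting algebras, given by a set of defining equations `p ≈ q`. -/
structure HeytingVariety where
  equations : Set (HeytingTerm × HeytingTerm)

/-- A Heyting algebra belongs to a variety if it satisfies all the defining equations. -/
def HeytingVariety.Mem (V : HeytingVariety) (A : Type*) [HeytingAlgebra A] : Prop :=
  ∀ e ∈ V.equations, ∀ v : ℕ → A, e.1.eval v = e.2.eval v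

/-! ### Heyting frames and their algebras of Galois closed sets -/

/-- A Heyting frame: a polarity `N` between a monoid `W₀` and a set `W₁`, with an operation
`W₀ × W₁ → W₁` residuating the multiplication, whose relation `N` admits contraction, weakening
and exchange. -/
structure HeytingFrame (W₀ W₁ : Type*) where
  N : W₀ → W₁ → Prop
  op : W₀ → W₀ → W₀
  unit : W₀
  arrow : W₀ → W₁ → W₁
  op_assoc : ∀ w v x, op (op w v) x = op w (op v x)
  unit_op : ∀ w, op unit w = w
  op_unit : ∀ w, op w unit = w
  op_rel_iff : ∀ w v u, N (op w v) u ↔ N v (arrow w u)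
  contraction : ∀ w u, N (op w w) u → N w u
  weakening : ∀ w u, N unit u → N w u
  exchange : ∀ w v u, N (op w v) u → N (op v w) u

namespace HeytingFrame

variable {W₀ W₁ : Type*} (F : HeytingFrame W₀ W₁)

theorem rel_op_left {w v : W₀} {u : W₁} (h : F.N w u) : F.N (F.op w v) u := by
  have h1 : F.N (F.op w F.unit) u := by rwa [F.op_unit]
  exact (F.op_rel_iff _ _ _).2 (F.weakening _ _ ((F.op_rel_iff _ _ _).1 h1))

/-- For Galois closed sets `X`, `Y` of `W₀`, the Galois closed set
`X → Y = {w | ∀ v ∈ X, v ∘ w ∈ Y}`. -/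
def himp (X Y : Concept W₀ W₁ F.N) : Concept W₀ W₁ F.N :=
  Concept.ofIsExtent F.N {w | ∀ v ∈ X.extent, F.op v w ∈ Y.extent} <| by
    refine ⟨{u | ∃ v ∈ X.extent, ∃ z ∈ Y.intent, u = F.arrow v z}, ?_⟩
    ext w
    constructor
    · intro h v hv
      rw [← Y.lowerPolar_intent]
      intro z hz
      exact (F.op_rel_iff _ _ _).2 (h ⟨v, hv, z, hz, rfl⟩)
    · rintro h _ ⟨v, hv, z, hz, rfl⟩
      exact (F.op_rel_iff _ _ _).1 (Concept.rel_extent_intent (h v hv) hz)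

theorem le_himp_iff (Z X Y : Concept W₀ W₁ F.N) : Z ≤ F.himp X Y ↔ Z ⊓ X ≤ Y := by
  constructor
  · rintro h w ⟨hZ, hX⟩
    have h1 : F.op w w ∈ Y.extent := h hZ w hX
    rw [← Y.lowerPolar_intent]
    intro z hz
    exact F.contraction _ _ (Concept.rel_extent_intent h1 hz)
  · intro h w hw v hv
    refine h ⟨?_, ?_⟩
    · rw [← Z.lowerPolar_intent]
      intro z hz
      exact F.exchange _ _ _ (F.rel_op_left (Concept.rel_extent_intent hw hz))
    · rw [← X.lowerPolar_intent]
      intro z hz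
      exact F.rel_op_left (Concept.rel_extent_intent hv hz)

/-- The Heyting algebra of Galois closed sets of a Heyting frame; its lattice structure is that of
the concept lattice of `N`, that is, Galois closed subsets of `W₀` under inclusion. -/
@[reducible]
def heytingAlgebra : HeytingAlgebra (Concept W₀ W₁ F.N) where
  __ := (inferInstance : Lattice (Concept W₀ W₁ F.N))
  __ := (inferInstance : BoundedOrder (Concept W₀ W₁ F.N))
  himp := F.himp
  le_himp_iff := F.le_himp_iff
  compl X := F.himp X ⊥
  himp_bot _ := rfl

end HeytingFrame

/-! ### The MacNeille completion -/

/-- The Heyting frame `(A, A, ≤, ∧, 1, →)`. -/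
def macNeilleFrame (A : Type*) [HeytingAlgebra A] : HeytingFrame A A where
  N := (· ≤ ·)
  op a b := a ⊓ b
  unit := ⊤
  arrow a b := a ⇨ b
  op_assoc := inf_assoc
  unit_op := top_inf_eq
  op_unit := inf_top_eq
  op_rel_iff w v u := by rw [le_himp_iff, inf_comm]
  contraction w u h := by simpa using h
  weakening w u h := le_top.trans h
  exchange w v u h := by rwa [inf_comm]

/-- The MacNeille completion of a Heyting algebra: its Dedekind cuts. -/
def MacNeilleCompletion (A : Type*) [HeytingAlgebra A] : Type _ := DedekindCut A

instance MacNeilleCompletion.instHeytingAlgebra (A : Type*) [HeytingAlgebra A] :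
    HeytingAlgebra (MacNeilleCompletion A) :=
  (macNeilleFrame A).heytingAlgebra

/-! ### The hyper-MacNeille completion -/

/-- The Heyting frame on `A × A` with `(s, a) N (t, b)` iff `s ∨ t ∨ (a → b) = 1`. -/
def hyperMacNeilleFrame (A : Type*) [HeytingAlgebra A] : HeytingFrame (A × A) (A × A) where
  N w u := w.1 ⊔ u.1 ⊔ (w.2 ⇨ u.2) = ⊤
  op w v := (w.1 ⊔ v.1, w.2 ⊓ v.2)
  unit := (⊥, ⊤)
  arrow w u := (w.1 ⊔ u.1, w.2 ⇨ u.2)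
  op_assoc w v x := by simp [sup_assoc, inf_assoc]
  unit_op w := by simp
  op_unit w := by simp
  op_rel_iff w v u := by
    simp only
    rw [show v.2 ⇨ w.2 ⇨ u.2 = w.2 ⊓ v.2 ⇨ u.2 by rw [himp_himp, inf_comm],
      show v.1 ⊔ (w.1 ⊔ u.1) = w.1 ⊔ v.1 ⊔ u.1 by
        rw [← sup_assoc, sup_comm v.1]]
  contraction w u h := by simpa using h
  weakening w u h := by
    simp only [bot_sup_eq, top_himp] at h
    refine top_le_iff.1 (h ▸ ?_)
    exact sup_le_sup le_sup_right le_himp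
  exchange w v u h := by rwa [sup_comm v.1, inf_comm v.2]

/-- The hyper-MacNeille completion of a Heyting algebra: the Galois closed sets of the polarity
`(A × A, A × A, N)`, ordered by inclusion. -/
def HyperMacNeilleCompletion (A : Type*) [HeytingAlgebra A] : Type _ :=
  Concept (A × A) (A × A) (hyperMacNeilleFrame A).N

instance HyperMacNeilleCompletion.instHeytingAlgebra (A : Type*) [HeytingAlgebra A] :
    HeytingAlgebra (HyperMacNeilleCompletion A) :=
  (hyperMacNeilleFrame A).heytingAlgebra

/-! ### The canonical completion -/

/-- The prime filters of `A`, ordered by inclusion (the underlying poset of the dual Esakia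
space of `A`). -/
abbrev PrimeFilter (A : Type*) [HeytingAlgebra A] : Type _ :=
  {x : Order.PFilter A // x.IsPrime}

/-- The canonical completion of a Heyting algebra: the upsets of its poset of prime filters,
ordered by inclusion (`UpperSet` itself is ordered by reverse inclusion, whence the order dual). -/
def CanonicalCompletion (A : Type*) [HeytingAlgebra A] : Type _ :=
  (UpperSet (PrimeFilter A))ᵒᵈ

noncomputable instance CanonicalCompletion.instHeytingAlgebra (A : Type*) [HeytingAlgebra A] :
    HeytingAlgebra (CanonicalCompletion A) :=
  inferInstanceAs (HeytingAlgebra (UpperSet (PrimeFilter A))ᵒᵈ)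

/-! ### Closure of varieties under completions -/

universe u

/-- `V` is closed under MacNeille completions. -/
def HeytingVariety.ClosedUnderMacNeille (V : HeytingVariety) : Prop :=
  ∀ (A : Type u) [HeytingAlgebra A], V.Mem A → V.Mem (MacNeilleCompletion A)

/-- `V` is closed under hyper-MacNeille completions. -/
def HeytingVariety.ClosedUnderHyperMacNeille (V : HeytingVariety) : Prop :=
  ∀ (A : Type u) [HeytingAlgebra A], V.Mem A → V.Mem (HyperMacNeilleCompletion A)

/-- `V` is closed under canonical completions. -/
def HeytingVariety.ClosedUnderCanonical (V : HeytingVariety) : Prop :=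
  ∀ (A : Type u) [HeytingAlgebra A], V.Mem A → V.Mem (CanonicalCompletion A)

/-! ### Preservation of equations -/

/-! Both implications replace `A` by a quotient of a subalgebra of one of its powers. Such a
quotient satisfies the equations of `A`, so the assumed closure applies to it, and its completion
contains an isomorphic copy of the wanted completion of `A`.

For the hyper-MacNeille completion, take locally constant functions from the maximal ideals to `A`,
comparing values at `I` modulo the minimal prime filter complementary to `I`. The function equal to
`a` where `s ∈ I` and to `⊥` elsewhere represents a left point `(s, a)`; with `⊤` elsewhere it
represents a right point. These functions are join-dense and meet-dense and their order is the
relation `N`, so the MacNeille completion of the quotient is the hyper-MacNeille completion of `A`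
(`HyperMacNeilleCompletion.orderIso`).

For the canonical completion, pass to a saturated extension `B` (`finitaryConst_isSaturated`).
Saturation makes meets of prime filters and joins of their complements behave compactly in the
hyper-MacNeille completion of `B`. Sending an upset to the join of the meets of its filters is then
an embedding: this element is also the meet of the joins of the complements of the filters outside
the upset (`IsSaturated.le_upsetJoin`), which controls `⊓` and `⇨`. -/

theorem HeytingTerm.map_eval {A B : Type*} [HeytingAlgebra A] [HeytingAlgebra B]
    (φ : HeytingHom A B) (v : ℕ → A) (t : HeytingTerm) :
    φ (t.eval v) = t.eval (φ ∘ v) := by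
  induction t with
  | var n => rfl
  | bot => exact map_bot φ
  | top => exact map_top φ
  | inf p q hp hq => simp only [HeytingTerm.eval, map_inf, hp, hq]
  | sup p q hp hq => simp only [HeytingTerm.eval, map_sup, hp, hq]
  | imp p q hp hq => simp only [HeytingTerm.eval, map_himp, hp, hq]

namespace HeytingVariety

variable {V : HeytingVariety}

theorem Mem.of_injective {A B : Type*} [HeytingAlgebra A] [HeytingAlgebra B]
    (φ : HeytingHom A B) (hφ : Function.Injective φ) (h : V.Mem B) : V.Mem A := by
  intro e he v
  apply hφ
  rw [HeytingTerm.map_eval, HeytingTerm.map_eval, h e he]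

theorem Mem.of_surjective {A B : Type*} [HeytingAlgebra A] [HeytingAlgebra B]
    (φ : HeytingHom A B) (hφ : Function.Surjective φ) (h : V.Mem A) : V.Mem B := by
  intro e he v
  obtain ⟨w, rfl⟩ := hφ.comp_left v
  rw [← HeytingTerm.map_eval, ← HeytingTerm.map_eval, h e he]

/-- Evaluation at an index, as a Heyting homomorphism. -/
def _root_.HeytingHom.piEval {J A : Type*} [HeytingAlgebra A] (j : J) : HeytingHom (J → A) A where
  toFun f := f j
  map_sup' _ _ := rfl
  map_inf' _ _ := rfl
  map_bot' := rfl
  map_himp' _ _ := rfl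

theorem Mem.pi {A : Type*} [HeytingAlgebra A] (J : Type*) (h : V.Mem A) : V.Mem (J → A) := by
  intro e he v
  funext j
  have := h e he (HeytingHom.piEval j ∘ v)
  rwa [← HeytingTerm.map_eval, ← HeytingTerm.map_eval] at this

end HeytingVariety

/-! ### Subalgebras of Heyting algebras -/

/-- A subalgebra of a Heyting algebra. -/
structure HeytingSubalgebra (H : Type*) [HeytingAlgebra H] where
  carrier : Set H
  bot_mem : ⊥ ∈ carrier
  top_mem : ⊤ ∈ carrier
  sup_mem : ∀ {a b}, a ∈ carrier → b ∈ carrier → a ⊔ b ∈ carrier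
  inf_mem : ∀ {a b}, a ∈ carrier → b ∈ carrier → a ⊓ b ∈ carrier
  himp_mem : ∀ {a b}, a ∈ carrier → b ∈ carrier → a ⇨ b ∈ carrier

namespace HeytingSubalgebra

variable {H : Type*} [HeytingAlgebra H] (S : HeytingSubalgebra H)

instance : Max S.carrier := ⟨fun a b => ⟨a ⊔ b, S.sup_mem a.2 b.2⟩⟩
instance : Min S.carrier := ⟨fun a b => ⟨a ⊓ b, S.inf_mem a.2 b.2⟩⟩
instance : Bot S.carrier := ⟨⟨⊥, S.bot_mem⟩⟩
instance : Top S.carrier := ⟨⟨⊤, S.top_mem⟩⟩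
instance : HImp S.carrier := ⟨fun a b => ⟨a ⇨ b, S.himp_mem a.2 b.2⟩⟩
instance : Compl S.carrier := ⟨fun a => a ⇨ ⊥⟩

instance : HeytingAlgebra S.carrier :=
  Subtype.val_injective.heytingAlgebra _ Iff.rfl Iff.rfl (fun _ _ => rfl) (fun _ _ => rfl) rfl rfl
    (fun a => himp_bot a.1) (fun _ _ => rfl)

/-- The inclusion of a subalgebra. -/
def subtype : HeytingHom S.carrier H where
  toFun := Subtype.val
  map_sup' _ _ := rfl
  map_inf' _ _ := rfl
  map_bot' := rfl
  map_himp' _ _ := rfl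

end HeytingSubalgebra

/-! ### Quotients of Heyting algebras by filters -/

section Quotient

open Order

variable {H : Type*} [HeytingAlgebra H]

/-- The congruence of a filter. -/
def Order.PFilter.setoid (F : PFilter H) : Setoid H where
  r a b := a ⇨ b ∈ F ∧ b ⇨ a ∈ F
  iseqv :=
    { refl a := by simp
      symm h := ⟨h.2, h.1⟩
      trans h k :=
        ⟨PFilter.mem_of_le (himp_triangle _ _ _) (PFilter.inf_mem h.1 k.1),
          PFilter.mem_of_le (himp_triangle _ _ _) (PFilter.inf_mem k.2 h.2)⟩ }

/-- The quotient of a Heyting algebra by a filter. -/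
def HeytingQuotient (F : PFilter H) : Type _ := Quotient F.setoid

namespace HeytingQuotient

variable {F : PFilter H}

theorem inf_himp_mem {a b c d : H} (h : a ⇨ b ∈ F) (k : c ⇨ d ∈ F) : a ⊓ c ⇨ b ⊓ d ∈ F := by
  refine PFilter.mem_of_le ?_ (PFilter.inf_mem h k)
  rw [le_himp_iff, inf_inf_inf_comm]
  exact inf_le_inf himp_inf_le himp_inf_le

theorem sup_himp_mem {a b c d : H} (h : a ⇨ b ∈ F) (k : c ⇨ d ∈ F) : a ⊔ c ⇨ b ⊔ d ∈ F := by
  refine PFilter.mem_of_le ?_ (PFilter.inf_mem h k)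
  rw [sup_himp_distrib]
  exact inf_le_inf (himp_le_himp_left le_sup_left) (himp_le_himp_left le_sup_right)

theorem himp_himp_mem {a b c d : H} (h : b ⇨ a ∈ F) (k : c ⇨ d ∈ F) :
    (a ⇨ c) ⇨ (b ⇨ d) ∈ F := by
  refine PFilter.mem_of_le ?_ (PFilter.inf_mem h k)
  rw [le_himp_iff, inf_right_comm]
  refine (inf_le_inf_right _ (himp_triangle _ _ _)).trans (himp_triangle _ _ _)

instance : Max (HeytingQuotient F) :=
  ⟨Quotient.map₂ (· ⊔ ·) fun _ _ h _ _ k => ⟨sup_himp_mem h.1 k.1, sup_himp_mem h.2 k.2⟩⟩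
instance : Min (HeytingQuotient F) :=
  ⟨Quotient.map₂ (· ⊓ ·) fun _ _ h _ _ k => ⟨inf_himp_mem h.1 k.1, inf_himp_mem h.2 k.2⟩⟩
instance : HImp (HeytingQuotient F) :=
  ⟨Quotient.map₂ (· ⇨ ·) fun _ _ h _ _ k => ⟨himp_himp_mem h.2 k.1, himp_himp_mem h.1 k.2⟩⟩

/-- The class of an element. -/
def mk (F : PFilter H) (a : H) : HeytingQuotient F := Quotient.mk F.setoid a

theorem mk_surjective : Function.Surjective (mk F) := Quotient.exists_rep

theorem mk_eq_mk {a b : H} : mk F a = mk F b ↔ a ⇨ b ∈ F ∧ b ⇨ a ∈ F := Quotient.eq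

instance : PartialOrder (HeytingQuotient F) where
  le := Quotient.lift₂ (fun a b => a ⇨ b ∈ F) fun _ _ _ _ h k => propext
    ⟨fun m => (PFilter.mem_of_le (himp_triangle _ _ _)
        (PFilter.inf_mem (PFilter.mem_of_le (himp_triangle _ _ _) (PFilter.inf_mem h.2 m)) k.1)),
      fun m => (PFilter.mem_of_le (himp_triangle _ _ _)
        (PFilter.inf_mem (PFilter.mem_of_le (himp_triangle _ _ _) (PFilter.inf_mem h.1 m)) k.2))⟩
  le_refl := by
    rintro ⟨a⟩
    exact (mk_eq_mk.1 (rfl : mk F a = mk F a)).1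
  le_trans := by
    rintro ⟨a⟩ ⟨b⟩ ⟨c⟩ h k
    exact PFilter.mem_of_le (himp_triangle _ _ _) (PFilter.inf_mem h k)
  le_antisymm := by
    rintro ⟨a⟩ ⟨b⟩ h k
    exact mk_eq_mk.2 ⟨h, k⟩

theorem mk_le_mk {a b : H} : mk F a ≤ mk F b ↔ a ⇨ b ∈ F := Iff.rfl

theorem mk_mono {a b : H} (h : a ≤ b) : mk F a ≤ mk F b := by
  rw [mk_le_mk, himp_eq_top_iff.2 h]
  exact PFilter.top_mem

instance : HeytingAlgebra (HeytingQuotient F) where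
  sup := (· ⊔ ·)
  inf := (· ⊓ ·)
  le_sup_left := by
    rintro ⟨a⟩ ⟨b⟩
    exact mk_mono le_sup_left
  le_sup_right := by
    rintro ⟨a⟩ ⟨b⟩
    exact mk_mono le_sup_right
  sup_le := by
    rintro ⟨a⟩ ⟨b⟩ ⟨c⟩ h k
    refine mk_le_mk.2 ?_
    rw [sup_himp_distrib]
    exact PFilter.inf_mem h k
  inf_le_left := by
    rintro ⟨a⟩ ⟨b⟩
    exact mk_mono inf_le_left
  inf_le_right := by
    rintro ⟨a⟩ ⟨b⟩
    exact mk_mono inf_le_right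
  le_inf := by
    rintro ⟨a⟩ ⟨b⟩ ⟨c⟩ h k
    refine mk_le_mk.2 ?_
    rw [himp_inf_distrib]
    exact PFilter.inf_mem h k
  top := mk F ⊤
  le_top := by
    rintro ⟨a⟩
    exact mk_mono le_top
  bot := mk F ⊥
  bot_le := by
    rintro ⟨a⟩
    exact mk_mono bot_le
  himp := (· ⇨ ·)
  le_himp_iff := by
    rintro ⟨a⟩ ⟨b⟩ ⟨c⟩
    change a ⇨ b ⇨ c ∈ F ↔ a ⊓ b ⇨ c ∈ F
    rw [himp_himp]
  compl a := a ⇨ mk F ⊥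
  himp_bot _ := rfl

/-- The quotient map. -/
def mkHom (F : PFilter H) : HeytingHom H (HeytingQuotient F) where
  toFun := mk F
  map_sup' _ _ := rfl
  map_inf' _ _ := rfl
  map_bot' := rfl
  map_himp' _ _ := rfl

theorem mk_eq_top {a : H} : mk F a = ⊤ ↔ a ∈ F := by
  rw [← top_le_iff]
  exact mk_le_mk.trans (by rw [top_himp])

end HeytingQuotient

/-- Varieties are closed under quotients of subalgebras of powers. -/
theorem HeytingVariety.Mem.quotient_subalgebra_pi {V : HeytingVariety} {J A : Type*}
    [HeytingAlgebra A] (h : V.Mem A) (S : HeytingSubalgebra (J → A)) (F : PFilter S.carrier) :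
    V.Mem (HeytingQuotient F) :=
  ((h.pi J).of_injective S.subtype Subtype.val_injective).of_surjective
    (HeytingQuotient.mkHom F) HeytingQuotient.mk_surjective

end Quotient

/-! ### Polarities densely represented in a partial order -/

/-- If a polarity is represented in a partial order by a join-dense and a meet-dense map, then its
concept lattice is isomorphic to the lattice of Dedekind cuts of this order. -/
def Concept.orderIsoDedekindCut {W₀ W₁ L : Type*} [PartialOrder L] {N : W₀ → W₁ → Prop}
    (f : W₀ → L) (g : W₁ → L) (hN : ∀ w u, N w u ↔ f w ≤ g u)
    (hf : ∀ l l', (∀ w, f w ≤ l → f w ≤ l') → l ≤ l')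
    (hg : ∀ l l', (∀ u, l' ≤ g u → l ≤ g u) → l ≤ l') :
    Concept W₀ W₁ N ≃o DedekindCut L :=
  let toCut (X : Concept W₀ W₁ N) : DedekindCut L :=
    Concept.ofIsExtent _ (s := {l | ∀ u ∈ X.intent, l ≤ g u}) ⟨g '' X.intent, by
      ext l
      simp [lowerBounds]⟩
  let inv (C : DedekindCut L) : Concept W₀ W₁ N :=
    Concept.ofIsExtent _ (s := {w | f w ∈ C.extent}) ⟨{u | g u ∈ C.intent}, by
      ext w
      constructor
      · intro h
        change f w ∈ C.extent
        rw [← C.lowerPolar_intent]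
        intro c hc
        exact hg _ _ fun u hu => (hN _ _).1 (h (C.isUpperSet_intent_le hu hc))
      · intro h u hu
        exact (hN _ _).2 (Concept.rel_extent_intent h hu)⟩
  have toCut_inv (C : DedekindCut L) : toCut (inv C) = C := by
    -- Meet-density made the pullback of a cut an extent; join-density now shows that its intent is
    -- also the pullback.
    have key (u : W₁) : u ∈ (inv C).intent ↔ g u ∈ C.intent := by
      rw [← C.upperPolar_extent, ← (inv C).upperPolar_extent]
      constructor
      · intro h l hl
        exact hf _ _ fun w hw => (hN _ _).1 (h (C.isLowerSet_extent_le hw hl))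
      · intro h w hw
        exact (hN _ _).2 (h hw)
    refine Concept.ext (Set.ext fun l => ?_)
    change (∀ u ∈ (inv C).intent, l ≤ g u) ↔ l ∈ C.extent
    constructor
    · intro h
      rw [← C.lowerPolar_intent]
      intro c hc
      exact hg _ _ fun u hu => h u ((key u).2 (C.isUpperSet_intent_le hu hc))
    · intro h u hu
      exact Concept.rel_extent_intent h ((key u).1 hu)
  have inv_toCut (X : Concept W₀ W₁ N) : inv (toCut X) = X := by
    refine Concept.ext (Set.ext fun w => ?_)
    rw [← X.lowerPolar_intent]
    exact forall₂_congr fun u _ => (hN w u).symm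
  have toCut_mono : Monotone toCut := fun X Y h l hl u hu =>
    hl u (Concept.intent_subset_intent_iff.2 h hu)
  have inv_mono : Monotone inv := fun C D h w hw => h hw
  { toFun := toCut
    invFun := inv
    left_inv := inv_toCut
    right_inv := toCut_inv
    map_rel_iff' {X Y} :=
      ⟨fun h => by simpa only [Equiv.coe_fn_mk, inv_toCut] using inv_mono h, fun h => toCut_mono h⟩ }

/-! ### The hyper-MacNeille completion as a MacNeille completion -/

section LocallyConstant

open Order Order.Ideal

variable (A : Type*) [HeytingAlgebra A]

/-- The maximal ideals of `A`; their complements are the minimal prime filters. -/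
abbrev MaximalIdeal : Type _ := {I : Ideal A // I.IsMaximal}

variable {A}

namespace MaximalIdeal

theorem top_notMem (I : MaximalIdeal A) : ⊤ ∉ I.1 :=
  Ideal.isProper_iff_top_notMem.1 I.2.toIsProper

theorem inf_notMem (I : MaximalIdeal A) {a b : A} (ha : a ∉ I.1) (hb : b ∉ I.1) : a ⊓ b ∉ I.1 :=
  have := I.2
  fun h => (IsPrime.mem_or_mem (I := I.1) inferInstance h).elim ha hb

/-- Makes the basic open sets clopen: every maximal ideal containing `t` omits `s`. Functions
defined by cases on `s ∈ I` are therefore locally constant. -/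
theorem exists_sup_eq_top (I : MaximalIdeal A) {s : A} (hs : s ∉ I.1) :
    ∃ t ∈ I.1, s ⊔ t = ⊤ := by
  have h : (↑(I.1 ⊔ principal s) : Set A) = Set.univ :=
    I.2.maximal_proper (lt_sup_principal_of_notMem hs)
  have h1 : (⊤ : A) ∈ I.1 ⊔ principal s := by
    rw [← SetLike.mem_coe, h]
    trivial
  obtain ⟨t, ht, h2⟩ := (Lattice.mem_ideal_sup_principal s ⊤ I.1).1 h1
  exact ⟨t, ht, by rw [sup_comm]; exact top_le_iff.1 h2⟩

theorem exists_mem_of_ne_top {c : A} (hc : c ≠ ⊤) : ∃ I : MaximalIdeal A, c ∈ I.1 := by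
  obtain ⟨I, hcI, hI⟩ := (isProper_principal_iff.2 hc).exists_le_maximal
  exact ⟨⟨I, hI⟩, principal_le_iff.1 hcI⟩

end MaximalIdeal

variable (A)

/-- The functions from maximal ideals to `A` that are locally constant with respect to the
topology generated by the sets `{I | s ∈ I}`. -/
def locallyConstantSubalgebra : HeytingSubalgebra (MaximalIdeal A → A) :=
  have map₂ (op : A → A → A) {f g : MaximalIdeal A → A}
      (hf : ∀ I : MaximalIdeal A, ∃ s ∈ I.1, ∃ a, ∀ I' : MaximalIdeal A, s ∈ I'.1 → f I' = a)
      (hg : ∀ I : MaximalIdeal A, ∃ s ∈ I.1, ∃ a, ∀ I' : MaximalIdeal A, s ∈ I'.1 → g I' = a) (I : MaximalIdeal A) :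
      ∃ s ∈ I.1, ∃ a, ∀ I' : MaximalIdeal A, s ∈ I'.1 → op (f I') (g I') = a := by
    obtain ⟨s, hs, a, ha⟩ := hf I
    obtain ⟨t, ht, b, hb⟩ := hg I
    exact ⟨s ⊔ t, sup_mem hs ht, op a b, fun I' h => by
      rw [ha I' (I'.1.lower le_sup_left h), hb I' (I'.1.lower le_sup_right h)]⟩
  { carrier := {f | ∀ I : MaximalIdeal A, ∃ s ∈ I.1, ∃ a, ∀ I' : MaximalIdeal A, s ∈ I'.1 → f I' = a}
    bot_mem := fun I => ⟨⊥, I.1.bot_mem, ⊥, fun _ _ => rfl⟩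
    top_mem := fun I => ⟨⊥, I.1.bot_mem, ⊤, fun _ _ => rfl⟩
    sup_mem := map₂ (· ⊔ ·)
    inf_mem := map₂ (· ⊓ ·)
    himp_mem := map₂ (· ⇨ ·) }

/-- The filter of those locally constant functions that vanish nowhere modulo the minimal prime
filters. -/
def locallyConstantFilter : PFilter (locallyConstantSubalgebra A).carrier :=
  IsPFilter.toPFilter (F := {f | ∀ I, f.1 I ∉ I.1}) <|
    .of_def ⟨⊤, fun I => I.top_notMem⟩
      (fun f hf g hg => ⟨f ⊓ g, fun I => I.inf_notMem (hf I) (hg I), inf_le_left, inf_le_right⟩)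
      fun hfg hf I h => hf I (I.1.lower (hfg I) h)

variable {A}

theorem mk_le_mk_locallyConstant {f g : (locallyConstantSubalgebra A).carrier} :
    HeytingQuotient.mk (locallyConstantFilter A) f ≤ HeytingQuotient.mk _ g ↔
      ∀ I, f.1 I ⇨ g.1 I ∉ I.1 := Iff.rfl

open Classical in
/-- The function with value `a` where `s` vanishes and `c` elsewhere. -/
noncomputable def locallyConstantIte (c s a : A) : (locallyConstantSubalgebra A).carrier :=
  ⟨fun I => if s ∈ I.1 then a else c, fun I : MaximalIdeal A => by
    by_cases hs : s ∈ I.1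
    · exact ⟨s, hs, a, fun _ h => if_pos h⟩
    · obtain ⟨t, ht, hst⟩ := I.exists_sup_eq_top hs
      exact ⟨t, ht, c, fun I' h => if_neg fun h' => I'.top_notMem (hst ▸ sup_mem h' h)⟩⟩

theorem locallyConstantIte_of_mem {c s a : A} {I : MaximalIdeal A} (h : s ∈ I.1) :
    (locallyConstantIte c s a).1 I = a := if_pos h

theorem locallyConstantIte_of_notMem {c s a : A} {I : MaximalIdeal A} (h : s ∉ I.1) :
    (locallyConstantIte c s a).1 I = c := if_neg h

variable (A)

/-- The hyper-MacNeille completion is the MacNeille completion of an algebra of locally constant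
functions. -/
noncomputable def HyperMacNeilleCompletion.orderIso : HyperMacNeilleCompletion A ≃o
    MacNeilleCompletion (HeytingQuotient (locallyConstantFilter A)) :=
  Concept.orderIsoDedekindCut
    (fun w : A × A => HeytingQuotient.mk (locallyConstantFilter A) (locallyConstantIte ⊥ w.1 w.2))
    (fun u : A × A => HeytingQuotient.mk (locallyConstantFilter A) (locallyConstantIte ⊤ u.1 u.2))
    (by
      rintro ⟨s, a⟩ ⟨t, b⟩
      rw [mk_le_mk_locallyConstant]
      change s ⊔ t ⊔ (a ⇨ b) = ⊤ ↔ _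
      constructor
      · intro h I
        by_cases hs : s ∈ I.1
        · by_cases ht : t ∈ I.1
          · rw [locallyConstantIte_of_mem hs, locallyConstantIte_of_mem ht]
            exact fun h' => I.top_notMem (h ▸ sup_mem (sup_mem hs ht) h')
          · rw [locallyConstantIte_of_notMem ht, himp_top]
            exact I.top_notMem
        · rw [locallyConstantIte_of_notMem hs, bot_himp]
          exact I.top_notMem
      · intro h
        -- A join other than `⊤` lies in some maximal ideal `I`. Then `s` and `t` lie in `I`, so the
        -- two functions have values `a` and `b` there, while `a ⇨ b ∈ I`.
        by_contra hne
        obtain ⟨I, hI⟩ := MaximalIdeal.exists_mem_of_ne_top hne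
        have h1 := h I
        rw [locallyConstantIte_of_mem (I.1.lower (le_sup_left.trans le_sup_left) hI),
          locallyConstantIte_of_mem (I.1.lower (le_sup_right.trans le_sup_left) hI)] at h1
        exact h1 (I.1.lower le_sup_right hI))
    (by
      intro l l' h
      obtain ⟨f, rfl⟩ := HeytingQuotient.mk_surjective l
      obtain ⟨g, rfl⟩ := HeytingQuotient.mk_surjective l'
      rw [mk_le_mk_locallyConstant]
      intro I
      -- Near `I` the function `f` is constantly `a`, so the function for `(s, a)` lies below `f`
      -- everywhere and equals it at `I`.
      obtain ⟨s, hs, a, ha⟩ := f.2 I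
      have h1 := h (s, a) (HeytingQuotient.mk_mono fun I' => by
        change (locallyConstantIte ⊥ s a).1 I' ≤ f.1 I'
        by_cases hs' : s ∈ I'.1
        · rw [locallyConstantIte_of_mem hs', ha I' hs']
        · rw [locallyConstantIte_of_notMem hs']
          exact bot_le)
      have h2 := mk_le_mk_locallyConstant.1 h1 I
      rwa [locallyConstantIte_of_mem hs, ← ha I hs] at h2)
    (by
      intro l l' h
      obtain ⟨f, rfl⟩ := HeytingQuotient.mk_surjective l
      obtain ⟨g, rfl⟩ := HeytingQuotient.mk_surjective l'
      rw [mk_le_mk_locallyConstant]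
      intro I
      obtain ⟨s, hs, a, ha⟩ := g.2 I
      have h1 := h (s, a) (HeytingQuotient.mk_mono fun I' => by
        change g.1 I' ≤ (locallyConstantIte ⊤ s a).1 I'
        by_cases hs' : s ∈ I'.1
        · rw [locallyConstantIte_of_mem hs', ha I' hs']
        · rw [locallyConstantIte_of_notMem hs']
          exact le_top)
      have h2 := mk_le_mk_locallyConstant.1 h1 I
      rwa [locallyConstantIte_of_mem hs, ← ha I hs] at h2)

end LocallyConstant

/-- The order determines the implication, so the order isomorphism is already a Heyting
homomorphism. -/
theorem HeytingVariety.ClosedUnderMacNeille.closedUnderHyperMacNeille {V : HeytingVariety}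
    (h : HeytingVariety.ClosedUnderMacNeille.{u} V) :
    HeytingVariety.ClosedUnderHyperMacNeille.{u} V := by
  intro A _ hA
  have h1 := h _ (hA.quotient_subalgebra_pi _ (locallyConstantFilter A))
  exact h1.of_injective (HyperMacNeilleCompletion.orderIso A : HeytingHom _ _)
    (HyperMacNeilleCompletion.orderIso A).injective

/-! ### Saturated extensions -/

section Saturated

open Order

/-- A homomorphism of Heyting algebras such that each filter and each ideal of its domain can be
replaced, in any given inequality, by a single lower bound and a single upper bound. -/
def HeytingHom.IsSaturated {A B : Type*} [HeytingAlgebra A] [HeytingAlgebra B]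
    (ι : HeytingHom A B) : Prop :=
  ∀ (X : PFilter A) (Y : Ideal A) (t e c : B),
    (∀ a ∈ X, ∀ b ∈ Y, t ⊔ (e ⊓ ι a ⇨ ι b ⊔ c) ≠ ⊤) →
      ∃ d f : B, (∀ a ∈ X, d ≤ ι a) ∧ (∀ b ∈ Y, ι b ≤ f) ∧ t ⊔ (e ⊓ d ⇨ f ⊔ c) ≠ ⊤

variable (A : Type*) [HeytingAlgebra A]

/-- The functions on `ℕ → Finset A` that depend on finitely many coordinates. -/
def finitarySubalgebra : HeytingSubalgebra ((ℕ → Finset A) → A) :=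
  have map₂ (op : A → A → A) {f g : (ℕ → Finset A) → A}
      (hf : ∃ n, DependsOn f (Set.Iio n)) (hg : ∃ n, DependsOn g (Set.Iio n)) :
      ∃ n, DependsOn (fun j => op (f j) (g j)) (Set.Iio n) := by
    obtain ⟨m, hm⟩ := hf
    obtain ⟨n, hn⟩ := hg
    exact ⟨max m n, fun j k h => congrArg₂ op
      (hm.mono (Set.Iio_subset_Iio (le_max_left _ _)) h)
      (hn.mono (Set.Iio_subset_Iio (le_max_right _ _)) h)⟩
  { carrier := {f | ∃ n, DependsOn f (Set.Iio n)}
    bot_mem := ⟨0, fun _ _ _ => rfl⟩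
    top_mem := ⟨0, fun _ _ _ => rfl⟩
    sup_mem := map₂ (· ⊔ ·)
    inf_mem := map₂ (· ⊓ ·)
    himp_mem := map₂ (· ⇨ ·) }

/-- The filter of the functions that are eventually constant with value `⊤`. -/
def finitaryFilter : PFilter (finitarySubalgebra A).carrier :=
  IsPFilter.toPFilter (F := {f | ∃ i, ∀ j ≥ i, f.1 j = ⊤}) <|
    .of_def ⟨⊤, ⊥, fun _ _ => rfl⟩
      (by
        classical
        rintro f ⟨i, hi⟩ g ⟨k, hk⟩
        refine ⟨f ⊓ g, ⟨i ⊔ k, fun j hj => ?_⟩, inf_le_left, inf_le_right⟩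
        change f.1 j ⊓ g.1 j = ⊤
        rw [hi j (le_sup_left.trans hj), hk j (le_sup_right.trans hj), inf_idem])
      fun hfg ⟨i, hi⟩ => ⟨i, fun j hj => top_le_iff.1 ((hi j hj).ge.trans (hfg j))⟩

variable {A}

theorem mk_finitary_eq_top {f : (finitarySubalgebra A).carrier} :
    HeytingQuotient.mk (finitaryFilter A) f = ⊤ ↔ ∃ i, ∀ j ≥ i, f.1 j = ⊤ :=
  HeytingQuotient.mk_eq_top

theorem mk_finitary_le_mk {f g : (finitarySubalgebra A).carrier} :
    HeytingQuotient.mk (finitaryFilter A) f ≤ HeytingQuotient.mk _ g ↔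
      ∃ i, ∀ j ≥ i, f.1 j ≤ g.1 j := by
  rw [HeytingQuotient.mk_le_mk]
  exact exists_congr fun i => forall₂_congr fun j _ => himp_eq_top_iff

variable (A) in
/-- The embedding by constant functions. -/
def finitaryConst : HeytingHom A (HeytingQuotient (finitaryFilter A)) where
  toFun a := HeytingQuotient.mk _ ⟨fun _ => a, 0, fun _ _ _ => rfl⟩
  map_sup' _ _ := rfl
  map_inf' _ _ := rfl
  map_bot' := rfl
  map_himp' _ _ := rfl

theorem eq_top_of_finitaryConst {a : A} (h : finitaryConst A a = ⊤) : a = ⊤ := by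
  obtain ⟨i, hi⟩ := mk_finitary_eq_top.1 h
  exact hi i le_rfl

open Classical in
-- Some coordinate `n` is irrelevant to `t`, `e` and `c`. Let `d` be the meet of the members of `X`
-- listed in `j n`, and `f` the join of the members of `Y` listed there; these are eventually beyond
-- any given element. At a single index they are still elements of `X` and `Y`.
theorem finitaryConst_isSaturated : (finitaryConst A).IsSaturated := by
  intro X Y t e c h
  obtain ⟨t, rfl⟩ := HeytingQuotient.mk_surjective t
  obtain ⟨e, rfl⟩ := HeytingQuotient.mk_surjective e
  obtain ⟨c, rfl⟩ := HeytingQuotient.mk_surjective c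
  obtain ⟨n, ht, he, hc⟩ : ∃ n, DependsOn t.1 (Set.Iio n) ∧ DependsOn e.1 (Set.Iio n) ∧
      DependsOn c.1 (Set.Iio n) := by
    obtain ⟨n₁, h₁⟩ := t.2
    obtain ⟨n₂, h₂⟩ := e.2
    obtain ⟨n₃, h₃⟩ := c.2
    exact ⟨max n₁ (max n₂ n₃),
      h₁.mono (Set.Iio_subset_Iio (le_max_left _ _)),
      h₂.mono (Set.Iio_subset_Iio ((le_max_left _ _).trans (le_max_right _ _))),
      h₃.mono (Set.Iio_subset_Iio ((le_max_right _ _).trans (le_max_right _ _)))⟩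
  let d : (finitarySubalgebra A).carrier :=
    ⟨fun j => ((j n).filter (· ∈ X)).inf id, n + 1, fun j k h => by
      simp only [h n (Nat.lt_succ_self n)]⟩
  let f : (finitarySubalgebra A).carrier :=
    ⟨fun j => ((j n).filter (· ∈ Y)).sup id, n + 1, fun j k h => by
      simp only [h n (Nat.lt_succ_self n)]⟩
  refine ⟨HeytingQuotient.mk _ d, HeytingQuotient.mk _ f, fun a ha => ?_, fun b hb => ?_,
    fun htop => ?_⟩
  · exact mk_finitary_le_mk.2 ⟨fun _ => {a}, fun j hj =>
      Finset.inf_le (f := id) (Finset.mem_filter.2 ⟨hj n (Finset.mem_singleton_self a), ha⟩)⟩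
  · exact mk_finitary_le_mk.2 ⟨fun _ => {b}, fun j hj =>
      Finset.le_sup (f := id) (Finset.mem_filter.2 ⟨hj n (Finset.mem_singleton_self b), hb⟩)⟩
  · obtain ⟨i, hi⟩ := mk_finitary_eq_top.1 htop
    refine h (d.1 i) ?_ (f.1 i) ?_ (mk_finitary_eq_top.2 ⟨i, fun j hj => ?_⟩)
    · exact Finset.inf_mem (X : Set A) PFilter.top_mem (fun _ ha _ hb => PFilter.inf_mem ha hb) _ _
        fun a ha => (Finset.mem_filter.1 ha).2
    · exact Finset.sup_mem (Y : Set A) Y.bot_mem (fun _ ha _ hb => Ideal.sup_mem ha hb) _ _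
        fun a ha => (Finset.mem_filter.1 ha).2
    · have hk := hi (Function.update j n (i n)) (le_update_iff.2 ⟨le_rfl, fun k _ => hj k⟩)
      have agree (k) (hk : k ∈ Set.Iio n) : Function.update j n (i n) k = j k :=
        Function.update_of_ne (ne_of_lt hk) _ _
      change t.1 j ⊔ (e.1 j ⊓ d.1 i ⇨ f.1 i ⊔ c.1 j) = ⊤
      rw [← ht agree, ← he agree, ← hc agree]
      have hd : d.1 i = d.1 (Function.update j n (i n)) := by simp [d]
      have hf : f.1 i = f.1 (Function.update j n (i n)) := by simp [f]
      rw [hd, hf]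
      exact hk

end Saturated

/-! ### The canonical completion inside a hyper-MacNeille completion -/

section Canonical

open Order

variable {A B : Type*} [HeytingAlgebra A] [HeytingAlgebra B]

theorem PrimeFilter.exists_of_disjoint {F : PFilter A} {I : Ideal A}
    (h : Disjoint (F : Set A) I) : ∃ x : PrimeFilter A, F ≤ x.1 ∧ ∀ a ∈ x.1, a ∉ I := by
  obtain ⟨J, hJ, hIJ, hFJ⟩ := DistribLattice.prime_ideal_of_disjoint_filter_ideal h
  refine ⟨⟨hJ.toPrimePair.F, hJ.toPrimePair.F_isPrime⟩, fun a ha => ?_, fun a ha h => ?_⟩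
  · exact Set.disjoint_left.1 hFJ ha
  · exact ha (hIJ h)

/-- The cut rule for `N`, with side components `s` and `t`. -/
theorem sup_himp_eq_top_trans {s t a b c : B} (h : s ⊔ (a ⇨ b) = ⊤) (k : t ⊔ (b ⇨ c) = ⊤) :
    s ⊔ t ⊔ (a ⇨ c) = ⊤ := by
  refine top_le_iff.1 (le_trans ?_ (sup_le_sup_left (himp_triangle a b c) _))
  rw [sup_inf_left, sup_right_comm, h, sup_assoc s t, k]
  simp

namespace HeytingHom

variable (ι : HeytingHom A B)

/-- The meet of a prime filter in the hyper-MacNeille completion of an extension. -/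
def filterMeet (x : PrimeFilter A) : Concept (B × B) (B × B) (hyperMacNeilleFrame B).N :=
  Concept.ofAttributes _ {u | ∃ a ∈ x.1, u = (⊥, ι a)}

/-- The join of the complement of a prime filter in the hyper-MacNeille completion of an
extension. -/
def idealJoin (x : PrimeFilter A) : Concept (B × B) (B × B) (hyperMacNeilleFrame B).N :=
  Concept.ofObjects _ {w | ∃ b ∉ x.1, w = (⊥, ι b)}

variable {ι}

theorem mem_filterMeet {x : PrimeFilter A} {w : B × B} :
    w ∈ (ι.filterMeet x).extent ↔ ∀ a ∈ x.1, w.1 ⊔ (w.2 ⇨ ι a) = ⊤ := by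
  constructor
  · intro h a ha
    have h1 : w.1 ⊔ ⊥ ⊔ (w.2 ⇨ ι a) = ⊤ := h ⟨a, ha, rfl⟩
    rwa [sup_bot_eq] at h1
  · rintro h _ ⟨a, ha, rfl⟩
    change w.1 ⊔ ⊥ ⊔ (w.2 ⇨ ι a) = ⊤
    rw [sup_bot_eq, h a ha]

theorem mem_idealJoin {x : PrimeFilter A} {u : B × B} :
    u ∈ (ι.idealJoin x).intent ↔ ∀ b ∉ x.1, u.1 ⊔ (ι b ⇨ u.2) = ⊤ := by
  constructor
  · intro h b hb
    have h1 : ⊥ ⊔ u.1 ⊔ (ι b ⇨ u.2) = ⊤ := h ⟨b, hb, rfl⟩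
    rwa [bot_sup_eq] at h1
  · rintro h _ ⟨b, hb, rfl⟩
    change ⊥ ⊔ u.1 ⊔ (ι b ⇨ u.2) = ⊤
    rw [bot_sup_eq, h b hb]

theorem mk_mem_filterMeet {x : PrimeFilter A} {d : B} (h : ∀ a ∈ x.1, d ≤ ι a) :
    (⊥, d) ∈ (ι.filterMeet x).extent :=
  mem_filterMeet.2 fun a ha => by simp [h a ha]

theorem mk_mem_idealJoin {x : PrimeFilter A} {f : B} (h : ∀ b ∉ x.1, ι b ≤ f) :
    (⊥, f) ∈ (ι.idealJoin x).intent :=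
  mem_idealJoin.2 fun a ha => by simp [h a ha]

theorem mem_idealJoin_of_himp {x : PrimeFilter A} {w : B × B} {b : A} (hb : b ∉ x.1)
    (h : w.1 ⊔ (w.2 ⇨ ι b) = ⊤) : w ∈ (ι.idealJoin x).extent := by
  rw [← Concept.lowerPolar_intent]
  intro u hu
  exact sup_himp_eq_top_trans h (mem_idealJoin.1 hu b hb)

theorem filterMeet_le_idealJoin {x y : PrimeFilter A} {a : A} (ha : a ∈ x.1) (ha' : a ∉ y.1) :
    ι.filterMeet x ≤ ι.idealJoin y := fun _ hw =>
  mem_idealJoin_of_himp ha' (mem_filterMeet.1 hw a ha)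

/-- Compactness of the filter meet: otherwise saturation, applied with the trivial ideal, gives a
lower bound `d` of the filter with `(⊥, d)` in the meet but not related to `u`. -/
theorem IsSaturated.exists_of_mem_filterMeet (hι : ι.IsSaturated) {x : PrimeFilter A} {u : B × B}
    (hu : u ∈ (ι.filterMeet x).intent) : ∃ a ∈ x.1, u.1 ⊔ (ι a ⇨ u.2) = ⊤ := by
  by_contra! hne
  obtain ⟨d, f, hd, -, hdf⟩ := hι x.1 (Ideal.principal ⊥) u.1 ⊤ u.2 fun a ha b hb => by
    obtain rfl : b = ⊥ := le_bot_iff.1 hb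
    simpa using hne a ha
  have h : ⊥ ⊔ u.1 ⊔ (d ⇨ u.2) = ⊤ :=
    Concept.rel_extent_intent (r := (hyperMacNeilleFrame B).N)
      (mk_mem_filterMeet hd) hu
  refine hdf (top_le_iff.1 (h.ge.trans ?_))
  rw [bot_sup_eq, top_inf_eq]
  exact sup_le_sup_left (himp_le_himp_left le_sup_right) _

theorem IsSaturated.exists_of_mem_idealJoin (hι : ι.IsSaturated) {x : PrimeFilter A} {w : B × B}
    (hw : w ∈ (ι.idealJoin x).extent) : ∃ b ∉ x.1, w.1 ⊔ (w.2 ⇨ ι b) = ⊤ := by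
  by_contra! hne
  obtain ⟨d, f, -, hf, hdf⟩ := hι (PFilter.principal ⊤) x.2.compl_ideal.toIdeal w.1 w.2 ⊥
    fun a ha b hb => by
      obtain rfl : a = ⊤ := top_le_iff.1 ha
      simpa using hne b hb
  have h : w.1 ⊔ ⊥ ⊔ (w.2 ⇨ f) = ⊤ :=
    Concept.rel_extent_intent (r := (hyperMacNeilleFrame B).N)
      hw (mk_mem_idealJoin hf)
  refine hdf (top_le_iff.1 (h.ge.trans ?_))
  rw [sup_bot_eq, sup_bot_eq]
  exact sup_le_sup_left (himp_le_himp_right inf_le_left) _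

/-- Compactness on both sides at once, for `w` in the implication from the filter meet to the ideal
join; here saturation must bound filter and ideal simultaneously. -/
theorem IsSaturated.exists_of_forall_op (hι : ι.IsSaturated) {x : PrimeFilter A} {w : B × B}
    (hw : ∀ v ∈ (ι.filterMeet x).extent,
      (hyperMacNeilleFrame B).op v w ∈ (ι.idealJoin x).extent) :
    ∃ a ∈ x.1, ∃ b ∉ x.1, w.1 ⊔ (w.2 ⊓ ι a ⇨ ι b) = ⊤ := by
  by_contra! hne
  obtain ⟨d, f, hd, hf, hdf⟩ := hι x.1 x.2.compl_ideal.toIdeal w.1 w.2 ⊥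
    fun a ha b hb => by simpa using hne a ha b hb
  have h : ⊥ ⊔ w.1 ⊔ ⊥ ⊔ (d ⊓ w.2 ⇨ f) = ⊤ :=
    Concept.rel_extent_intent (r := (hyperMacNeilleFrame B).N)
      (hw _ (mk_mem_filterMeet hd)) (mk_mem_idealJoin hf)
  rw [bot_sup_eq, sup_bot_eq, inf_comm] at h
  exact hdf (by rwa [sup_bot_eq])

theorem IsSaturated.not_filterMeet_le_idealJoin (hι : ι.IsSaturated)
    (htop : ∀ a, ι a = ⊤ → a = ⊤) (x : PrimeFilter A) : ¬ ι.filterMeet x ≤ ι.idealJoin x := by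
  intro h
  obtain ⟨a, ha, b, hb, hab⟩ := hι.exists_of_forall_op (x := x) (w := (⊥, ⊤)) fun v hv => by
    change (hyperMacNeilleFrame B).op v (hyperMacNeilleFrame B).unit ∈ _
    rw [(hyperMacNeilleFrame B).op_unit v]
    exact h hv
  rw [bot_sup_eq, top_inf_eq, ← map_himp] at hab
  exact hb (PFilter.mem_of_le (himp_eq_top_iff.1 (htop _ hab)) ha)

/-! ### The embedding of upsets of prime filters -/

variable (ι)

/-- The join of the meets of the prime filters in an upset. -/
def upsetJoin (u : CanonicalCompletion A) :
    Concept (B × B) (B × B) (hyperMacNeilleFrame B).N :=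
  ⨆ x ∈ OrderDual.ofDual u, ι.filterMeet x

variable {ι}

theorem filterMeet_le_upsetJoin {x : PrimeFilter A} {u : CanonicalCompletion A}
    (hx : x ∈ OrderDual.ofDual u) : ι.filterMeet x ≤ ι.upsetJoin u :=
  le_iSup₂ (f := fun x (_ : x ∈ OrderDual.ofDual u) => ι.filterMeet x) x hx

theorem upsetJoin_le_idealJoin {x : PrimeFilter A} {u : CanonicalCompletion A}
    (hx : x ∉ OrderDual.ofDual u) : ι.upsetJoin u ≤ ι.idealJoin x := by
  refine iSup₂_le fun y hy => ?_
  obtain ⟨a, ha, ha'⟩ := Set.not_subset.1 fun h : (y.1 : Set A) ⊆ x.1 =>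
    hx ((OrderDual.ofDual u).upper (show y ≤ x from h) hy)
  exact filterMeet_le_idealJoin ha ha'

/-- For `w` in `Z` and `v` in the intent of the join, let `F` be the elements of `A` above `w` and
`I` those below `v`. A common element gives `w N v` by cut. Otherwise a prime filter `x` contains
`F` and avoids `I`: if `x` is in the upset, compactness of its meet puts an element of `x` in `I`;
if not, compactness of its ideal join puts an element outside `x` in `F`. -/
theorem IsSaturated.le_upsetJoin (hι : ι.IsSaturated) {u : CanonicalCompletion A}
    {Z : Concept (B × B) (B × B) (hyperMacNeilleFrame B).N}
    (hZ : ∀ x ∉ OrderDual.ofDual u, Z ≤ ι.idealJoin x) : Z ≤ ι.upsetJoin u := by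
  intro w hw
  rw [← Concept.lowerPolar_intent]
  intro v hv
  let F : PFilter A := IsPFilter.toPFilter (F := {b | w.1 ⊔ (w.2 ⇨ ι b) = ⊤}) <|
    .of_def ⟨⊤, by simp⟩
      (fun a ha b hb => ⟨a ⊓ b, by
        change w.1 ⊔ (w.2 ⇨ ι (a ⊓ b)) = ⊤
        rw [map_inf, himp_inf_distrib, sup_inf_left, ha, hb, inf_idem], inf_le_left, inf_le_right⟩)
      fun hab ha => top_le_iff.1 (ha.ge.trans
        (sup_le_sup_left (himp_le_himp_left (OrderHomClass.mono ι hab)) _))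
  let I : Ideal A := IsIdeal.toIdeal (I := {a | v.1 ⊔ (ι a ⇨ v.2) = ⊤})
    { IsLowerSet := fun a b hab ha => top_le_iff.1 (ha.ge.trans
        (sup_le_sup_left (himp_le_himp_right (OrderHomClass.mono ι hab)) _))
      Nonempty := ⟨⊥, by simp⟩
      Directed := fun a ha b hb => ⟨a ⊔ b, by
        change v.1 ⊔ (ι (a ⊔ b) ⇨ v.2) = ⊤
        rw [map_sup, sup_himp_distrib, sup_inf_left, ha, hb, inf_idem], le_sup_left, le_sup_right⟩ }
  by_cases hFI : Disjoint (F : Set A) I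
  · exfalso
    obtain ⟨x, hFx, hxI⟩ := PrimeFilter.exists_of_disjoint hFI
    by_cases hx : x ∈ OrderDual.ofDual u
    · obtain ⟨a, ha, h⟩ := hι.exists_of_mem_filterMeet
        (Concept.intent_subset_intent_iff.2 (filterMeet_le_upsetJoin hx) hv)
      exact hxI a ha h
    · obtain ⟨b, hb, h⟩ := hι.exists_of_mem_idealJoin (hZ x hx hw)
      exact hb (hFx h)
  · obtain ⟨a, ha, ha'⟩ := Set.not_disjoint_iff.1 hFI
    exact sup_himp_eq_top_trans ha ha'

theorem upsetJoin_mono {u v : CanonicalCompletion A} (h : u ≤ v) :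
    ι.upsetJoin u ≤ ι.upsetJoin v :=
  iSup₂_le fun _ hx => filterMeet_le_upsetJoin (h hx)

theorem IsSaturated.upsetJoin_inf (hι : ι.IsSaturated) (u v : CanonicalCompletion A) :
    ι.upsetJoin (u ⊓ v) = ι.upsetJoin u ⊓ ι.upsetJoin v := by
  refine le_antisymm (le_inf (upsetJoin_mono inf_le_left) (upsetJoin_mono inf_le_right))
    (hι.le_upsetJoin fun x hx => ?_)
  by_cases hu : x ∈ OrderDual.ofDual u
  · exact inf_le_right.trans (upsetJoin_le_idealJoin fun hv => hx ⟨hu, hv⟩)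
  · exact inf_le_left.trans (upsetJoin_le_idealJoin hu)

/-- The canonical completion maps into the hyper-MacNeille completion of a saturated extension. -/
def IsSaturated.canonicalHom (hι : ι.IsSaturated) :
    HeytingHom (CanonicalCompletion A) (HyperMacNeilleCompletion B) where
  toFun := ι.upsetJoin
  map_sup' u v := by
    change ι.upsetJoin (u ⊔ v) = ι.upsetJoin u ⊔ ι.upsetJoin v
    refine le_antisymm (iSup₂_le fun x hx => ?_)
      (sup_le (upsetJoin_mono le_sup_left) (upsetJoin_mono le_sup_right))
    rcases hx with hx | hx
    · exact (filterMeet_le_upsetJoin hx).trans le_sup_left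
    · exact (filterMeet_le_upsetJoin hx).trans le_sup_right
  map_inf' := hι.upsetJoin_inf
  map_bot' := by
    change ι.upsetJoin ⊥ = ⊥
    exact le_bot_iff.1 (iSup₂_le fun x (hx : x ∈ (⊤ : UpperSet (PrimeFilter A))) => hx.elim)
  map_himp' u v := by
    change ι.upsetJoin (u ⇨ v) = (hyperMacNeilleFrame B).himp (ι.upsetJoin u) (ι.upsetJoin v)
    refine le_antisymm (((hyperMacNeilleFrame B).le_himp_iff _ _ _).2 ?_)
      (hι.le_upsetJoin fun x hx w hw => ?_)
    · rw [← hι.upsetJoin_inf]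
      exact upsetJoin_mono himp_inf_le
    -- As in Kripke semantics, `x` fails `u ⇨ v` because of some larger `y`. Compactness at `y` then
    -- yields `a ⇨ b` above `w`, and it is not in `x` since `x ≤ y`.
    · obtain ⟨y, hxy, hyu, hyv⟩ : ∃ y : PrimeFilter A, x ≤ y ∧ y ∈ OrderDual.ofDual u ∧
          y ∉ OrderDual.ofDual v := by
        by_contra! h
        have h1 : (OrderDual.toDual (UpperSet.Ici x) : CanonicalCompletion A) ≤ u ⇨ v :=
          le_himp_iff.2 fun y hy => h y hy.1 hy.2
        exact hx (h1 (le_refl x))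
      obtain ⟨a, ha, b, hb, h⟩ := hι.exists_of_forall_op (x := y) (w := w) fun z hz =>
        upsetJoin_le_idealJoin hyv (hw z (filterMeet_le_upsetJoin hyu hz))
      refine mem_idealJoin_of_himp (b := a ⇨ b) (fun hab => hb ?_) ?_
      · exact PFilter.mem_of_le himp_inf_le (PFilter.inf_mem (hxy hab) ha)
      · rwa [map_himp, himp_himp]

/-- A filter `x` in `u` but not in `v` would squeeze its own meet below its own ideal join. -/
theorem IsSaturated.canonicalHom_injective (hι : ι.IsSaturated) (htop : ∀ a, ι a = ⊤ → a = ⊤) :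
    Function.Injective hι.canonicalHom := by
  have key {u v : CanonicalCompletion A} (h : ι.upsetJoin u ≤ ι.upsetJoin v) : u ≤ v := by
    intro x hx
    by_contra hx'
    exact hι.not_filterMeet_le_idealJoin htop x
      ((filterMeet_le_upsetJoin hx).trans (h.trans (upsetJoin_le_idealJoin hx')))
  intro u v h
  change ι.upsetJoin u = ι.upsetJoin v at h
  exact le_antisymm (key h.le) (key h.ge)

end HeytingHom

end Canonical

theorem HeytingVariety.ClosedUnderHyperMacNeille.closedUnderCanonical {V : HeytingVariety}
    (h : HeytingVariety.ClosedUnderHyperMacNeille.{u} V) :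
    HeytingVariety.ClosedUnderCanonical.{u} V := by
  intro A _ hA
  have h1 := h _ (hA.quotient_subalgebra_pi _ (finitaryFilter A))
  exact h1.of_injective finitaryConst_isSaturated.canonicalHom
    (finitaryConst_isSaturated.canonicalHom_injective fun _ => eq_top_of_finitaryConst)

theorem mainTheorem10 (V : HeytingVariety) :
    (HeytingVariety.ClosedUnderMacNeille.{u} V →
      HeytingVariety.ClosedUnderHyperMacNeille.{u} V) ∧
    (HeytingVariety.ClosedUnderHyperMacNeille.{u} V →
      HeytingVariety.ClosedUnderCanonical.{u} V) :=
  ⟨fun h => h.closedUnderHyperMacNeille, fun h => h.closedUnderCanonical⟩
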